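/- Let $m\in\mathbb N$ and let $\Sigma_{m+1}=\{0,1,\dots,m\}^{\mathbb N}$ be the space of sequences $\underline x=(x_1,x_2,\dots)$, with the left shift $\sigma(x_1,x_2,\dots)=(x_2,x_3,\dots)$ and the lexicographic order $<$. Fix any real $b>1$ and equip $\Sigma_{m+1}$ with the metric $d_b(\underline x,\underline y)=\sum_{i\ge 1}|x_i-y_i|\,b^{-i}$; let $\dim_H$ denote the Hausdorff dimension with respect to $d_b$ (with $\dim_H\emptyset=0$). For $\underline c,\underline d\in\Sigma_{m+1}$ with $\underline c<\underline d$ put $$M'_{\underline c,\underline d}=\{\underline x\in\Sigma_{m+1}:\ \underline c\le\sigma^n(\underline x)\le\underline d\ \text{ for all } n\ge 0\},$$ $$M_{\underline c,\underline d}=\{\underline x\in\Sigma_{m+1}:\ \underline c\le\sigma^n(\underline x)<\underline x\le\underline d\ \text{ for all } n\ge 1\}.$$ Then $$\dim_H(M_{\underline c,\underline d})=\dim_H(M'_{\underline c,\underline d}).$$ -/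

import Mathlib

noncomputable section

namespace SymbolicInterval

/-- The full one-sided shift space on the alphabet `{0, 1, …, m}`.
The entry written `x_{i+1}` in one-based notation is `x i` here. -/
abbrev FullShift (m : ℕ) : Type := ℕ → Fin (m + 1)

/-- The left shift. -/
def shift {m : ℕ} (x : FullShift m) : FullShift m := fun i => x (i + 1)

/-- The `i`-th summand of the distance with base `b`, `|x_{i+1} - y_{i+1}| / b ^ (i + 1)`. -/
def distTerm {m : ℕ} (b : ℝ) (x y : FullShift m) (i : ℕ) : ℝ :=
  |((x i : ℕ) : ℝ) - ((y i : ℕ) : ℝ)| / b ^ (i + 1)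

theorem distTerm_nonneg {m : ℕ} {b : ℝ} (hb : 1 < b) (x y : FullShift m) (i : ℕ) :
    0 ≤ distTerm b x y i := by
  have : 0 < b := by linarith
  unfold distTerm
  positivity

theorem summable_distTerm {m : ℕ} {b : ℝ} (hb : 1 < b) (x y : FullShift m) :
    Summable (distTerm b x y) := by
  have hb0 : 0 < b := by linarith
  have hs : Summable (fun i : ℕ => (m : ℝ) * (b⁻¹) ^ (i + 1)) :=
    (((summable_nat_add_iff 1).2
      (summable_geometric_of_lt_one (by positivity) (inv_lt_one_of_one_lt₀ hb)))).mul_left _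
  refine Summable.of_nonneg_of_le (distTerm_nonneg hb x y) (fun i => ?_) hs
  have hx : ((x i : ℕ) : ℝ) ≤ m := by exact_mod_cast Nat.lt_succ_iff.1 (x i).2
  have hy : ((y i : ℕ) : ℝ) ≤ m := by exact_mod_cast Nat.lt_succ_iff.1 (y i).2
  have hx0 : (0 : ℝ) ≤ ((x i : ℕ) : ℝ) := Nat.cast_nonneg _
  have hy0 : (0 : ℝ) ≤ ((y i : ℕ) : ℝ) := Nat.cast_nonneg _
  have h : |((x i : ℕ) : ℝ) - ((y i : ℕ) : ℝ)| ≤ m := by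
    rw [abs_le]; constructor <;> linarith
  rw [distTerm, div_eq_mul_inv, inv_pow]
  exact mul_le_mul_of_nonneg_right h (by positivity)

/-- The metric `d_b(x, y) = ∑_{i ≥ 1} |x_i - y_i| / b ^ i` on the full shift, for a base `b > 1`. -/
@[reducible] def shiftMetric (m : ℕ) (b : ℝ) (hb : 1 < b) : MetricSpace (FullShift m) where
  dist x y := ∑' i, distTerm b x y i
  dist_self x := by simp [distTerm]
  dist_comm x y := by simp [distTerm, abs_sub_comm]
  dist_triangle x y z := by
    have hxy := summable_distTerm hb x y
    have hyz := summable_distTerm hb y z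
    rw [← hxy.tsum_add hyz]
    refine (summable_distTerm hb x z).tsum_le_tsum (fun i => ?_) (hxy.add hyz)
    have hb0 : 0 < b := by linarith
    unfold distTerm
    rw [← add_div]
    gcongr
    exact abs_sub_le _ _ _
  eq_of_dist_eq_zero := by
    intro x y h
    change ∑' i, distTerm b x y i = 0 at h
    have h0 := ((hasSum_zero_iff_of_nonneg (distTerm_nonneg hb x y)).1
      (h ▸ (summable_distTerm hb x y).hasSum))
    funext i
    have hi : distTerm b x y i = 0 := congrFun h0 i
    have hb0 : b ^ (i + 1) ≠ 0 := by
      have : 0 < b := by linarith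
      positivity
    rw [distTerm, div_eq_zero_iff, or_iff_left hb0, abs_eq_zero, sub_eq_zero] at hi
    exact Fin.ext (by exact_mod_cast hi)

/-- The Hausdorff dimension of a subset of the full shift with respect to the metric `d_b`
(so the empty set has dimension `0`). -/
def hausdorffDim {m : ℕ} (b : ℝ) (hb : 1 < b) (S : Set (FullShift m)) : ENNReal :=
  @dimH (FullShift m) (@MetricSpace.toEMetricSpace _ (shiftMetric m b hb)) S

/-- `{x | c ≤ σ^n(x) ≤ d for all n ≥ 0}` in the lexicographic order: the maximal invariant set
contained in the order interval `[c, d]`. -/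
def maximalInvariantSet {m : ℕ} (c d : FullShift m) : Set (FullShift m) :=
  {x | ∀ n : ℕ, toLex c ≤ toLex (shift^[n] x) ∧ toLex (shift^[n] x) ≤ toLex d}

/-- `{x | c ≤ σ^n(x) < x ≤ d for all n ≥ 1}` in the lexicographic order: the right endpoints of
invariant sets contained in the order interval `[c, d]`. -/
def rightEndpointSet {m : ℕ} (c d : FullShift m) : Set (FullShift m) :=
  {x | ∀ n : ℕ, 1 ≤ n → toLex c ≤ toLex (shift^[n] x) ∧ toLex (shift^[n] x) < toLex x ∧
    toLex x ≤ toLex d}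

end SymbolicInterval

end

/-!
Write `X` for `maximalInvariantSet c d` and `M` for `rightEndpointSet c d`. Clearly `M ⊆ X`, so the
content is `s ≤ dim M` for every `s < dim X`. It rests on the fact that `X`, being cut out by an
interval, contains horseshoes of almost full dimension.

*Horseshoes.* If `s < dim X`, then the language of `X` satisfies `∑ b ^ (-s * |u|) = ∞`, since
otherwise the cylinders of its words would be covers of `X` of bounded `s`-dimensional mass
(`hausdorffDim_maximalInvariantSet_le`). The sequences that may follow a word `u` form an order
convex set, so at most two of the cylinders of blocks of a given length meet this set without being
contained in it (`encard_not_covers_le`). When blocks are so long that `b ^ (-s * N) ≤ 1 / 4`, two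
exceptional blocks per word do not account for the divergence of the sum, so it must come from words
leading to a block `a` whose whole cylinder may follow. Passing through such blocks until one
recurs gives, at arbitrarily large lengths `n`, at least `b ^ (s * n)` words from a block `a` back
to its full cylinder (`exists_loops`). These words form a set `V`, and all their infinite
concatenations lie in `X` (`exists_horseshoe`, `concat_mem_maximalInvariantSet`).

*Right endpoints.* Let `θ` be the lexicographically largest word of length `2 * n` occurring in a
concatenation of words of `V`. Remove from `V` the at most `n + 1` words of length `n` occurring in
`θ`. A stretch of length `2 * n` in a concatenation of the remaining words contains one of them
completely, so it is smaller than `θ`. Fix a finite concatenation `p` of words of `V` in which `θ`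
occurs. If `ω` is a concatenation of remaining words, then `p ω` lies in `X`, and its largest tail
starts inside `p`; the last such tail lies in `M` (`exists_shift_iterate_mem_rightEndpointSet`).
Hence the set of all `p ω` is covered by the images of `M` under prepending an initial word of `p`.
These finitely many maps do not increase distances, so `M` has at least the dimension of the set of
all `p ω`. This is at least `s`, because `V` still has `b ^ (s * n)` words if it was constructed for
a slightly larger `s` (`le_dimH_range_of_le_edist`, `le_hausdorffDim_rightEndpointSet`).
-/

open scoped ENNReal NNReal Topology

/-! ### Words counted with weights -/

/-- The generating function `∑_{u ∈ S} x ^ |u|` of a set `S` of finite words, counted by length,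
at the point `x`. -/
noncomputable def wordSum {α : Type*} (x : ℝ≥0∞) (S : Set (List α)) : ℝ≥0∞ :=
  ∑' u : S, x ^ (u : List α).length

section WordSum

variable {α : Type*} {x : ℝ≥0∞}

theorem wordSum_mono {S T : Set (List α)} (h : S ⊆ T) : wordSum x S ≤ wordSum x T :=
  ENNReal.tsum_mono_subtype (fun u : List α => x ^ u.length) h

theorem wordSum_union_le (S T : Set (List α)) :
    wordSum x (S ∪ T) ≤ wordSum x S + wordSum x T :=
  ENNReal.tsum_union_le (fun u : List α => x ^ u.length) S T

theorem wordSum_biUnion_le {ι : Type*} (s : Finset ι) (T : ι → Set (List α)) :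
    wordSum x (⋃ i ∈ s, T i) ≤ ∑ i ∈ s, wordSum x (T i) :=
  ENNReal.tsum_biUnion_le (fun u : List α => x ^ u.length) s T

theorem wordSum_singleton (u : List α) : wordSum x {u} = x ^ u.length := by
  simp [wordSum]

theorem wordSum_append_le (S T : Set (List α)) :
    wordSum x (Set.image2 (· ++ ·) S T) ≤ wordSum x S * wordSum x T := by
  have hf : Function.Surjective (fun p : S × T =>
      (⟨(p.1 : List α) ++ p.2, Set.mem_image2_of_mem p.1.2 p.2.2⟩ :
        Set.image2 (· ++ ·) S T)) := by
    rintro ⟨_, u, hu, v, hv, rfl⟩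
    exact ⟨(⟨u, hu⟩, ⟨v, hv⟩), rfl⟩
  calc wordSum x (Set.image2 (· ++ ·) S T)
      ≤ ∑' p : S × T, x ^ ((p.1 : List α) ++ (p.2 : List α)).length :=
        ENNReal.tsum_le_tsum_comp_of_surjective hf
          (fun u : Set.image2 (· ++ ·) S T => x ^ (u : List α).length)
    _ = wordSum x S * wordSum x T := by
        rw [ENNReal.tsum_prod']
        simp only [List.length_append, pow_add, ENNReal.tsum_mul_left, ENNReal.tsum_mul_right]
        rfl

theorem wordSum_of_length_eq {S : Set (List α)} {n : ℕ} (h : ∀ u ∈ S, u.length = n) :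
    wordSum x S = S.encard * x ^ n := by
  rw [← ENNReal.tsum_set_const]
  exact tsum_congr fun u => by rw [h u u.2]

theorem wordSum_le_tsum_length (S : Set (List α)) :
    wordSum x S ≤ ∑' n, wordSum x {u ∈ S | u.length = n} := by
  refine le_trans (wordSum_mono (T := ⋃ n, {u ∈ S | u.length = n}) fun u hu => ?_)
    (ENNReal.tsum_iUnion_le_tsum (fun u : List α => x ^ u.length) _)
  exact Set.mem_iUnion.2 ⟨u.length, hu, rfl⟩

theorem wordSum_le_of_forall_length_le {S : Set (List α)} {K : ℝ≥0∞}
    (h : ∀ k, wordSum x {u ∈ S | u.length ≤ k} ≤ K) : wordSum x S ≤ K := by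
  classical
  rw [wordSum, ENNReal.tsum_eq_iSup_sum]
  refine iSup_le fun F => ?_
  refine le_trans ?_ (h (F.sup fun u => (u : List α).length))
  have hmap : ∑ u ∈ F, x ^ (u : List α).length =
      ∑ u ∈ F.map (Function.Embedding.subtype (· ∈ S)), x ^ u.length := by
    rw [Finset.sum_map]; rfl
  rw [hmap, ← Finset.tsum_subtype]
  refine wordSum_mono (x := x) fun u hu => ?_
  obtain ⟨v, hv, rfl⟩ := Finset.mem_map.1 hu
  exact ⟨v.2, Finset.le_sup (f := fun u : S => (u : List α).length) hv⟩

end WordSum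

theorem List.forall_mem_or_exists_first {α : Type*} (P : α → Prop) (u : List α) :
    (∀ b ∈ u, P b) ∨ ∃ v b w, u = v ++ ([b] ++ w) ∧ (∀ c ∈ v, P c) ∧ ¬ P b := by
  induction u with
  | nil => simp
  | cons a u ih =>
    by_cases ha : P a
    · rcases ih with h | ⟨v, b, w, rfl, hv, hb⟩
      · exact Or.inl (by simpa [ha] using h)
      · exact Or.inr ⟨a :: v, b, w, rfl, by simpa [ha] using hv, hb⟩
    · exact Or.inr ⟨[], a, u, rfl, by simp, ha⟩

/-! ### Loops in a language -/

section Links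

variable {α : Type*} {Cov : List α → α → Prop}

/-- There are at least `r ^ n` words of length `n` that start with `a` and cover `a₂`. Here
`Cov u a₂` is an abstract relation between words and letters, to be thought of as saying that `u`
can be followed by every sequence that starts with `a₂`. -/
def HasLinks (Cov : List α → α → Prop) (r : ℝ≥0) (a a₂ : α) (n : ℕ) : Prop :=
  ∃ V : Finset (List α), (∀ u ∈ V, u.length = n ∧ (∃ t, u = a :: t) ∧ Cov u a₂) ∧
    r ^ n ≤ (V.card : ℝ≥0)

theorem HasLinks.trans {r : ℝ≥0} (hcomp : ∀ u a t b, Cov u a → Cov (a :: t) b →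
    Cov (u ++ a :: t) b) {a₁ a₂ a₃ : α} {n k : ℕ} (h₁ : HasLinks Cov r a₁ a₂ n)
    (h₂ : HasLinks Cov r a₂ a₃ k) : HasLinks Cov r a₁ a₃ (n + k) := by
  classical
  obtain ⟨V, hV, hVc⟩ := h₁
  obtain ⟨W, hW, hWc⟩ := h₂
  refine ⟨Finset.image₂ (· ++ ·) V W, ?_, ?_⟩
  · intro w hw
    obtain ⟨u, hu, v, hv, rfl⟩ := Finset.mem_image₂.1 hw
    obtain ⟨hul, ⟨t, rfl⟩, huc⟩ := hV u hu
    obtain ⟨hvl, ⟨s, rfl⟩, hvc⟩ := hW v hv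
    exact ⟨by rw [List.length_append, hul, hvl], ⟨t ++ a₂ :: s, rfl⟩, hcomp _ _ _ _ huc hvc⟩
  · have hinj : Set.InjOn (fun p : List α × List α => p.1 ++ p.2) (V ×ˢ W : Finset _) := by
      rintro ⟨u, v⟩ huv ⟨u', v'⟩ huv' h
      simp only [Finset.coe_product, Set.mem_prod, Finset.mem_coe] at huv huv'
      obtain ⟨h1, h2⟩ := List.append_inj h (by rw [(hV u huv.1).1, (hV u' huv'.1).1])
      exact Prod.ext h1 h2
    have : (Finset.image₂ (· ++ ·) V W).card = V.card * W.card :=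
      Finset.card_image₂_iff.2 (by simpa [Function.uncurry_def] using hinj)
    rw [this, pow_add, Nat.cast_mul]
    gcongr

end Links

section Loops

variable {α : Type*} [Fintype α] {L : Set (List α)} {Cov : List α → α → Prop} {x : ℝ≥0∞}

theorem exists_wordSum_cons_eq_top (hx : x ≠ ∞) (hsum : wordSum x L = ∞) :
    ∃ a, wordSum x {u | a :: u ∈ L} = ∞ := by
  by_contra! h
  have hsub : L ⊆ {[]} ∪ ⋃ a ∈ (Finset.univ : Finset α),
      Set.image2 (· ++ ·) {[a]} {u | a :: u ∈ L} := by
    rintro (_ | ⟨a, u⟩) hu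
    · simp
    · right
      exact Set.mem_biUnion (Finset.mem_univ a) ⟨[a], rfl, u, hu, rfl⟩
  refine absurd hsum (ne_top_of_le_ne_top ?_ ((wordSum_mono hsub).trans
    ((wordSum_union_le _ _).trans (add_le_add le_rfl (wordSum_biUnion_le _ _)))))
  refine ENNReal.add_ne_top.2 ⟨by simp [wordSum_singleton], ?_⟩
  refine ENNReal.sum_ne_top.2 fun a _ => ne_top_of_le_ne_top ?_ (wordSum_append_le _ _)
  exact ENNReal.mul_ne_top (by simpa [wordSum_singleton] using hx) (h a)

/-- Call a letter `a` heavy if the words of `L` starting with `a` have infinite weight. Splitting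
at the first letter that is not heavy shows that from a heavy letter the words all of whose letters
are heavy still have infinite weight. -/
theorem wordSum_heavy_eq_top (hx : x ≠ ∞) (hpre : ∀ u v, u ++ v ∈ L → u ∈ L)
    (hsuf : ∀ u v, u ++ v ∈ L → v ∈ L) {a : α} (ha : wordSum x {u | a :: u ∈ L} = ∞) :
    wordSum x {u | a :: u ∈ L ∧ ∀ b ∈ u, wordSum x {v | b :: v ∈ L} = ∞} = ∞ := by
  classical
  by_contra hS
  set S := {u | a :: u ∈ L ∧ ∀ b ∈ u, wordSum x {v | b :: v ∈ L} = ∞} with hSdef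
  have hsub : {u | a :: u ∈ L} ⊆ S ∪ ⋃ b ∈ Finset.univ.filter
      (fun b : α => wordSum x {v | b :: v ∈ L} ≠ ∞),
      Set.image2 (· ++ ·) S (Set.image2 (· ++ ·) {[b]} {v | b :: v ∈ L}) := by
    intro u hu
    rcases List.forall_mem_or_exists_first (fun b => wordSum x {v | b :: v ∈ L} = ∞) u with
      h | ⟨v, b, w, rfl, hv, hb⟩
    · exact Or.inl ⟨hu, h⟩
    · right
      refine Set.mem_biUnion (x := b) (by simpa using hb) ⟨v, ⟨hpre (a :: v) ([b] ++ w) hu, hv⟩,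
        _, ⟨[b], rfl, w, hsuf (a :: v) ([b] ++ w) hu, rfl⟩, rfl⟩
  refine absurd ha (ne_top_of_le_ne_top ?_ ((wordSum_mono hsub).trans
    ((wordSum_union_le _ _).trans (add_le_add le_rfl (wordSum_biUnion_le _ _)))))
  refine ENNReal.add_ne_top.2 ⟨hS, ENNReal.sum_ne_top.2 fun b hb => ?_⟩
  refine ne_top_of_le_ne_top (ENNReal.mul_ne_top hS ?_) (wordSum_append_le _ _)
  refine ne_top_of_le_ne_top (ENNReal.mul_ne_top ?_ ?_) (wordSum_append_le _ _)
  · simpa [wordSum_singleton] using hx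
  · exact (Finset.mem_filter.1 hb).2

/-- If at most two one-letter extensions of each word fail to be covering, then from a heavy letter
the words covering some fixed heavy letter have infinite weight: the at most two exceptional
extensions only contribute a factor `2 * x ≤ 1 / 2`. -/
theorem exists_wordSum_cov_eq_top (hx : 4 * x ≤ 1) (hpre : ∀ u v, u ++ v ∈ L → u ∈ L)
    (hsuf : ∀ u v, u ++ v ∈ L → v ∈ L)
    (hCov : ∀ u, {a | u ++ [a] ∈ L ∧ ¬ Cov u a}.encard ≤ 2)
    {a : α} (ha : wordSum x {u | a :: u ∈ L} = ∞) :
    ∃ b, wordSum x {v | b :: v ∈ L} = ∞ ∧ wordSum x {u | Cov (a :: u) b ∧ a :: u ∈ L} = ∞ := by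
  classical
  have hx' : x ≠ ∞ := by rintro rfl; simp at hx
  by_contra! hΓ
  set S := {u | a :: u ∈ L ∧ ∀ b ∈ u, wordSum x {v | b :: v ∈ L} = ∞} with hSdef
  set E := Finset.univ.filter (fun b : α => wordSum x {v | b :: v ∈ L} = ∞) with hE
  set D : ℝ≥0∞ := 1 + ∑ b ∈ E, wordSum x {u | Cov (a :: u) b ∧ a :: u ∈ L} * x with hD
  have hDtop : D ≠ ∞ := by
    refine ENNReal.add_ne_top.2 ⟨ENNReal.one_ne_top, ENNReal.sum_ne_top.2 fun b hb => ?_⟩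
    exact ENNReal.mul_ne_top (hΓ b (Finset.mem_filter.1 hb).2) hx'
  -- Remove the last letter of a word of `S`: either the rest covers it, and `D` accounts for these
  -- words, or it is one of the at most two exceptional letters for a shorter word of `S`.
  have key : ∀ k, wordSum x {u ∈ S | u.length ≤ k} ≤ 2 * D := by
    intro k
    induction k with
    | zero =>
      refine (wordSum_mono (T := {[]}) ?_).trans ?_
      · rintro u ⟨_, hu⟩
        simpa using hu
      · rw [wordSum_singleton, List.length_nil, pow_zero]
        exact le_trans (le_self_add : (1 : ℝ≥0∞) ≤ D) (by rw [two_mul]; exact le_self_add)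
    | succ k ih =>
      set T := {u ∈ S | u.length ≤ k} with hT
      have hsub : {u ∈ S | u.length ≤ k + 1} ⊆ ({[]} ∪ ⋃ b ∈ E,
          Set.image2 (· ++ ·) {u | Cov (a :: u) b ∧ a :: u ∈ L} {[b]}) ∪
          ⋃ u ∈ T, (fun b => u ++ [b]) '' {b | (a :: u) ++ [b] ∈ L ∧ ¬ Cov (a :: u) b} := by
        rintro w ⟨⟨hwL, hwE⟩, hwk⟩
        rcases List.eq_nil_or_concat w with rfl | ⟨u, b, rfl⟩
        · simp
        have huL : a :: u ∈ L := hpre (a :: u) [b] (by simpa using hwL)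
        by_cases hc : Cov (a :: u) b
        · refine Or.inl (Or.inr (Set.mem_biUnion (x := b) ?_ ⟨u, ⟨hc, huL⟩, [b], rfl, by simp⟩))
          simpa [hE] using hwE b (by simp)
        · refine Or.inr (Set.mem_biUnion (x := u) ⟨⟨huL, fun e he => hwE e (by simp [he])⟩, ?_⟩
            ⟨b, ⟨by simpa using hwL, hc⟩, by simp⟩)
          simpa using hwk
      have h1 : wordSum x (⋃ b ∈ E,
          Set.image2 (· ++ ·) {u | Cov (a :: u) b ∧ a :: u ∈ L} {[b]}) ≤
          ∑ b ∈ E, wordSum x {u | Cov (a :: u) b ∧ a :: u ∈ L} * x := by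
        refine (wordSum_biUnion_le _ _).trans (Finset.sum_le_sum fun b _ => ?_)
        simpa [wordSum_singleton] using
          wordSum_append_le (x := x) {u | Cov (a :: u) b ∧ a :: u ∈ L} {[b]}
      have h2 : wordSum x (⋃ u ∈ T, (fun b => u ++ [b]) ''
          {b | (a :: u) ++ [b] ∈ L ∧ ¬ Cov (a :: u) b}) ≤ wordSum x T * (2 * x) := by
        refine (ENNReal.tsum_biUnion_le_tsum (fun u : List α => x ^ u.length) T _).trans ?_
        rw [wordSum, ← ENNReal.tsum_mul_right]
        refine ENNReal.tsum_le_tsum fun u => ?_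
        change wordSum x _ ≤ _
        rw [wordSum_of_length_eq (n := (u : List α).length + 1)
          (by rintro _ ⟨b, _, rfl⟩; simp), pow_succ]
        have h3 : ((fun b => (u : List α) ++ [b]) ''
            {b | (a :: (u : List α)) ++ [b] ∈ L ∧ ¬ Cov (a :: u) b}).encard ≤ 2 :=
          (Set.encard_image_le _ _).trans (hCov _)
        have h4 : (((fun b => (u : List α) ++ [b]) ''
            {b | (a :: (u : List α)) ++ [b] ∈ L ∧ ¬ Cov (a :: u) b}).encard : ℝ≥0∞) ≤ 2 := by
          exact_mod_cast ENat.toENNReal_le.2 h3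
        calc _ ≤ 2 * (x ^ (u : List α).length * x) := by gcongr
          _ = _ := by ring
      calc wordSum x {u ∈ S | u.length ≤ k + 1}
          ≤ D + wordSum x T * (2 * x) := by
            refine (wordSum_mono hsub).trans ((wordSum_union_le _ _).trans
              (add_le_add ((wordSum_union_le _ _).trans ?_) h2))
            rw [wordSum_singleton, List.length_nil, pow_zero]
            exact add_le_add le_rfl h1
        _ ≤ D + 2 * D * (2 * x) := by gcongr
        _ = D + D * (4 * x) := by ring
        _ ≤ D + D * 1 := by gcongr
        _ = 2 * D := by ring
  refine absurd (wordSum_heavy_eq_top hx' hpre hsuf ha)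
    (ne_top_of_le_ne_top (ENNReal.mul_ne_top ENNReal.ofNat_ne_top hDtop)
      (wordSum_le_of_forall_length_le key))

/-- A power series that diverges at `x` has coefficients of growth rate at least `1 / x`. -/
theorem exists_hasLinks {r : ℝ≥0} {a b : α} (hr : (r : ℝ≥0∞) * x < 1)
    (h : wordSum x {u | Cov (a :: u) b ∧ a :: u ∈ L} = ∞) :
    ∃ n, HasLinks Cov r a b (n + 1) := by
  classical
  by_contra! hn
  refine absurd h (ne_top_of_le_ne_top ?_ (wordSum_le_tsum_length _))
  have hle : ∀ n, wordSum x {u ∈ {u | Cov (a :: u) b ∧ a :: u ∈ L} | u.length = n} ≤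
      r * ((r : ℝ≥0∞) * x) ^ n := by
    intro n
    rw [wordSum_of_length_eq (n := n) (fun u hu => hu.2)]
    set T := {u ∈ {u | Cov (a :: u) b ∧ a :: u ∈ L} | u.length = n} with hT
    have hfin : T.Finite := (List.finite_length_eq α n).subset fun u hu => hu.2
    have hcard : (hfin.toFinset.card : ℝ≥0) ≤ r ^ (n + 1) := by
      by_contra! hlt
      refine hn n ⟨hfin.toFinset.image (a :: ·), ?_, ?_⟩
      · intro w hw
        obtain ⟨u, hu, rfl⟩ := Finset.mem_image.1 hw
        have hu' := hfin.mem_toFinset.1 hu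
        exact ⟨by simpa using hu'.2, ⟨u, rfl⟩, hu'.1.1⟩
      · rw [Finset.card_image_of_injective _ (List.cons_injective)]
        exact hlt.le
    have h2 : (T.encard : ℝ≥0∞) ≤ (r : ℝ≥0∞) ^ (n + 1) := by
      rw [hfin.encard_eq_coe_toFinset_card]
      have := ENNReal.coe_le_coe.2 hcard
      simpa using this
    calc _ ≤ (r : ℝ≥0∞) ^ (n + 1) * x ^ n := by gcongr
      _ = _ := by rw [mul_pow]; ring
  refine ne_top_of_le_ne_top ?_ (ENNReal.tsum_le_tsum hle)
  rw [ENNReal.tsum_mul_left, ENNReal.tsum_geometric]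
  exact ENNReal.mul_ne_top ENNReal.coe_ne_top
    (ENNReal.inv_ne_top.2 (tsub_pos_of_lt hr).ne')

/-- **Horseshoes from growth.** If a factorial language has infinite weight at `x`, and all but at
most two one-letter extensions of each word are covering, then for every `r < 1 / x` some letter
`a` has, at arbitrarily large lengths `n`, at least `r ^ n` loops: words of length `n` that start
with `a` and cover `a`. -/
theorem exists_loops {r : ℝ≥0} (hx : 4 * x ≤ 1) (hr : (r : ℝ≥0∞) * x < 1)
    (hpre : ∀ u v, u ++ v ∈ L → u ∈ L) (hsuf : ∀ u v, u ++ v ∈ L → v ∈ L)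
    (hCov : ∀ u, {a | u ++ [a] ∈ L ∧ ¬ Cov u a}.encard ≤ 2)
    (hcomp : ∀ u a t b, Cov u a → Cov (a :: t) b → Cov (u ++ a :: t) b)
    (hsum : wordSum x L = ∞) :
    ∃ a, ∀ k, ∃ n, k ≤ n ∧ HasLinks Cov r a a n := by
  have hx' : x ≠ ∞ := by rintro rfl; simp at hx
  set H := {a : α // wordSum x {u | a :: u ∈ L} = ∞} with hH
  -- Links lead from every heavy letter to another one; following them, some letter recurs, and the
  -- links along this cycle compose to loops.
  have hstep : ∀ a : H, ∃ b : H, ∃ n, HasLinks Cov r a.1 b.1 (n + 1) := by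
    rintro ⟨a, ha⟩
    obtain ⟨b, hb, hab⟩ := exists_wordSum_cov_eq_top (Cov := Cov) hx hpre hsuf hCov ha
    exact ⟨⟨b, hb⟩, exists_hasLinks hr hab⟩
  choose φ ν hφ using hstep
  have hiter : ∀ k (a : H), ∃ n, k ≤ n ∧ HasLinks Cov r a.1 (φ^[k + 1] a).1 n := by
    intro k
    induction k with
    | zero => exact fun a => ⟨ν a + 1, Nat.zero_le _, hφ a⟩
    | succ k ih =>
      intro a
      obtain ⟨n, hn, h⟩ := ih (φ a)
      exact ⟨ν a + 1 + n, by lia, (hφ a).trans hcomp h⟩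
  obtain ⟨a₀, ha₀⟩ := exists_wordSum_cons_eq_top hx' hsum
  obtain ⟨i, j, hij, h⟩ := Finite.exists_ne_map_eq_of_infinite
    (fun k : ℕ => φ^[k] (⟨a₀, ha₀⟩ : H))
  wlog hlt : i < j generalizing i j
  · exact this j i hij.symm h.symm (by lia)
  obtain ⟨p, rfl⟩ := Nat.exists_eq_add_of_lt hlt
  set a := φ^[i] (⟨a₀, ha₀⟩ : H) with ha
  have hper : φ^[p + 1] a = a := by
    rw [ha, ← Function.iterate_add_apply, show p + 1 + i = i + p + 1 by ring]
    exact h.symm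
  refine ⟨a.1, fun k => ?_⟩
  -- `k + 1` rounds of the cycle have length at least `k`, as every link has positive length.
  obtain ⟨n, hn, hlink⟩ := hiter ((p + 1) * (k + 1) - 1) a
  rw [Nat.sub_add_cancel (Nat.mul_pos p.succ_pos k.succ_pos), Function.iterate_mul,
    Function.iterate_fixed hper] at hlink
  refine ⟨n, le_trans ?_ hn, hlink⟩
  have : k + 1 ≤ (p + 1) * (k + 1) := Nat.le_mul_of_pos_left _ p.succ_pos
  lia

end Loops

namespace SymbolicInterval

/-! ### Prepending a word to a sequence -/

/-- The sequence consisting of the finite word `u` followed by the sequence `y`. -/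
def cat {α : Type*} : List α → (ℕ → α) → ℕ → α
  | [], y, i => y i
  | a :: _, _, 0 => a
  | _ :: u, y, i + 1 => cat u y i

section Cat

variable {α : Type*}

@[simp] theorem cat_nil (y : ℕ → α) : cat [] y = y := rfl

@[simp] theorem cat_cons_zero (a : α) (u : List α) (y : ℕ → α) : cat (a :: u) y 0 = a := rfl

@[simp] theorem cat_cons_succ (a : α) (u : List α) (y : ℕ → α) (i : ℕ) :
    cat (a :: u) y (i + 1) = cat u y i := rfl

theorem cat_append (u v : List α) (y : ℕ → α) : cat (u ++ v) y = cat u (cat v y) := by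
  induction u with
  | nil => rfl
  | cons a u ih =>
    funext i
    cases i with
    | zero => rfl
    | succ i => exact congrFun ih i

theorem cat_add_length (u : List α) (y : ℕ → α) (i : ℕ) : cat u y (i + u.length) = y i := by
  induction u with
  | nil => rfl
  | cons a u ih => exact ih

theorem cat_of_lt {u : List α} {i : ℕ} (h : i < u.length) (y : ℕ → α) : cat u y i = u[i] := by
  induction u generalizing i with
  | nil => simp at h
  | cons a u ih =>
    cases i with
    | zero => rfl
    | succ i => exact ih (by simpa using h)

theorem cat_ofFn_of_lt {n i : ℕ} (a : Fin n → α) (h : i < n) (y : ℕ → α) :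
    cat (List.ofFn a) y i = a ⟨i, h⟩ := by
  rw [cat_of_lt (by simpa using h)]
  simp

theorem toLex_cat_le_toLex_cat [LinearOrder α] (u : List α) {y y' : ℕ → α}
    (h : toLex y ≤ toLex y') : toLex (cat u y) ≤ toLex (cat u y') := by
  rcases h.eq_or_lt with h | ⟨i, hi, hlt⟩
  · rw [toLex_inj.1 h]
  · refine le_of_lt ⟨i + u.length, fun j hj => ?_, by simpa [cat_add_length] using hlt⟩
    rcases lt_or_ge j u.length with hju | hju
    · simp [cat_of_lt hju]
    · obtain ⟨k, rfl⟩ := Nat.exists_eq_add_of_le' hju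
      simpa [cat_add_length] using hi k (by lia)

theorem toLex_cat_ofFn_lt [LinearOrder α] {n : ℕ} {a a' : Fin n → α} (h : toLex a < toLex a')
    (y y' : ℕ → α) : toLex (cat (List.ofFn a) y) < toLex (cat (List.ofFn a') y') := by
  obtain ⟨i, hi, hlt⟩ := h
  refine ⟨i, fun j hj => ?_, ?_⟩
  · simpa [cat_ofFn_of_lt _ (lt_trans hj i.2)] using hi ⟨j, lt_trans hj i.2⟩ hj
  · simpa [cat_ofFn_of_lt _ i.2] using hlt

end Cat

variable {m : ℕ}

theorem shift_iterate_apply (n : ℕ) (x : FullShift m) (i : ℕ) : shift^[n] x i = x (i + n) := by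
  induction n generalizing x with
  | zero => rfl
  | succ n ih =>
    rw [Function.iterate_succ_apply, ih]
    rw [shift, add_assoc]

theorem shift_iterate_cat (u : List (Fin (m + 1))) (y : FullShift m) (n : ℕ) :
    shift^[u.length + n] (cat u y) = shift^[n] y := by
  funext i
  rw [shift_iterate_apply, shift_iterate_apply, show i + (u.length + n) = i + n + u.length by ring,
    cat_add_length]

theorem shift_iterate_length_cat (u : List (Fin (m + 1))) (y : FullShift m) :
    shift^[u.length] (cat u y) = y :=
  shift_iterate_cat u y 0

theorem shift_iterate_cat_of_le {u : List (Fin (m + 1))} {n : ℕ} (h : n ≤ u.length)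
    (y : FullShift m) : shift^[n] (cat u y) = cat (u.drop n) y := by
  conv_lhs => rw [← List.take_append_drop n u, cat_append]
  have := shift_iterate_length_cat (u.take n) (cat (u.drop n) y)
  rwa [List.length_take, min_eq_left h] at this

theorem cat_prefix (x : FullShift m) (n : ℕ) :
    cat (List.ofFn fun i : Fin n => x i) (shift^[n] x) = x := by
  funext i
  rcases lt_or_ge i n with h | h
  · rw [cat_ofFn_of_lt _ h]
  · obtain ⟨k, rfl⟩ := Nat.exists_eq_add_of_le' h
    rw [← shift_iterate_apply n (cat _ _)]
    have := shift_iterate_length_cat (List.ofFn fun i : Fin n => x i) (shift^[n] x)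
    rw [List.length_ofFn] at this
    rw [this, shift_iterate_apply]

/-! ### Blocks and follower sets -/

/-- The word obtained by writing out a list of blocks of length `N`. -/
def flat {α : Type*} {N : ℕ} (u : List (Fin N → α)) : List α := u.flatMap List.ofFn

section Flat

variable {α : Type*} {N : ℕ}

@[simp] theorem flat_nil : flat ([] : List (Fin N → α)) = [] := rfl

@[simp] theorem flat_cons (a : Fin N → α) (u : List (Fin N → α)) :
    flat (a :: u) = List.ofFn a ++ flat u := rfl

@[simp] theorem flat_append (u v : List (Fin N → α)) : flat (u ++ v) = flat u ++ flat v :=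
  List.flatMap_append

@[simp] theorem length_flat (u : List (Fin N → α)) : (flat u).length = N * u.length := by
  induction u with
  | nil => rfl
  | cons a u ih => simp [ih, mul_add, add_comm]

theorem flat_injective (hN : 0 < N) :
    Function.Injective (flat : List (Fin N → α) → List α) := by
  intro u v h
  induction u generalizing v with
  | nil =>
    cases v with
    | nil => rfl
    | cons b v =>
      have := congrArg List.length h
      simp at this; lia
  | cons a u ih =>
    cases v with
    | nil =>
      have := congrArg List.length h
      simp at this; lia
    | cons b v =>
      obtain ⟨h1, h2⟩ := List.append_inj h (by simp)
      rw [List.ofFn_injective h1, ih h2]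

end Flat

variable {c d : FullShift m} {N : ℕ}

theorem shift_iterate_mem_maximalInvariantSet {x : FullShift m}
    (hx : x ∈ maximalInvariantSet c d) (n : ℕ) : shift^[n] x ∈ maximalInvariantSet c d := by
  intro k
  rw [← Function.iterate_add_apply]
  exact hx _

/-- The lists of `N`-blocks that can be read at the start of a point of `maximalInvariantSet c d`.
As the set is shift invariant, this is its language, restricted to lengths divisible by `N`. -/
def blockLanguage (c d : FullShift m) (N : ℕ) : Set (List (Fin N → Fin (m + 1))) :=
  {u | ∃ y, cat (flat u) y ∈ maximalInvariantSet c d}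

theorem blockLanguage_prefix (u v : List (Fin N → Fin (m + 1)))
    (h : u ++ v ∈ blockLanguage c d N) : u ∈ blockLanguage c d N := by
  obtain ⟨y, hy⟩ := h
  exact ⟨cat (flat v) y, by rwa [← cat_append, ← flat_append]⟩

theorem blockLanguage_suffix (u v : List (Fin N → Fin (m + 1)))
    (h : u ++ v ∈ blockLanguage c d N) : v ∈ blockLanguage c d N := by
  obtain ⟨y, hy⟩ := h
  refine ⟨y, ?_⟩
  rw [flat_append, cat_append] at hy
  have := shift_iterate_mem_maximalInvariantSet hy (flat u).length
  rwa [shift_iterate_length_cat] at this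

/-- The whole cylinder of the block `a` lies in the follower set of `u`: in every sequence that
starts with `u a`, the tails starting inside `u` lie in `[c, d]`. -/
def Covers (c d : FullShift m) (u : List (Fin N → Fin (m + 1))) (a : Fin N → Fin (m + 1)) : Prop :=
  ∀ y : FullShift m, ∀ r < (flat u).length,
    toLex c ≤ toLex (shift^[r] (cat (flat u) (cat (List.ofFn a) y))) ∧
      toLex (shift^[r] (cat (flat u) (cat (List.ofFn a) y))) ≤ toLex d

theorem Covers.append {u t : List (Fin N → Fin (m + 1))} {a b : Fin N → Fin (m + 1)}
    (h₁ : Covers c d u a) (h₂ : Covers c d (a :: t) b) : Covers c d (u ++ a :: t) b := by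
  intro y r hr
  rw [flat_append, cat_append]
  rcases lt_or_ge r (flat u).length with h | h
  · have := h₁ (cat (flat t) (cat (List.ofFn b) y)) r h
    rwa [← cat_append (List.ofFn a), ← flat_cons] at this
  · obtain ⟨k, rfl⟩ := Nat.exists_eq_add_of_le h
    rw [shift_iterate_cat]
    exact h₂ y k (by simp only [flat_append, List.length_append] at hr; lia)

/-- The follower set of a word is order convex, so among the cylinders meeting it only the smallest
and the largest can fail to be contained in it. -/
theorem encard_not_covers_le (u : List (Fin N → Fin (m + 1))) :
    {a | u ++ [a] ∈ blockLanguage c d N ∧ ¬ Covers c d u a}.encard ≤ 2 := by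
  classical
  set S : Set (Lex (Fin N → Fin (m + 1))) :=
    {a | u ++ [ofLex a] ∈ blockLanguage c d N ∧ ¬ Covers c d u (ofLex a)} with hS
  have hSe : {a | u ++ [a] ∈ blockLanguage c d N ∧ ¬ Covers c d u a}.encard ≤ S.encard :=
    Set.encard_le_encard_of_injOn (f := toLex) (fun a ha => ha) toLex.injective.injOn
  refine hSe.trans ?_
  by_contra! hlt
  have hfin : S.Finite := Set.toFinite S
  rw [hfin.encard_eq_coe_toFinset_card] at hlt
  have hcard : 2 < hfin.toFinset.card := by exact_mod_cast hlt
  obtain ⟨a₁, a₂, a₃, h₁, h₂, h₃, h12, h23⟩ : ∃ a₁ a₂ a₃, a₁ ∈ S ∧ a₂ ∈ S ∧ a₃ ∈ S ∧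
      a₁ < a₂ ∧ a₂ < a₃ := by
    have hne : hfin.toFinset.Nonempty := Finset.card_pos.1 (by lia)
    have hex : ∃ a₂ ∈ hfin.toFinset, a₂ ∉ ({hfin.toFinset.min' hne, hfin.toFinset.max' hne} :
        Finset _) := by
      refine Finset.exists_mem_notMem_of_card_lt_card (lt_of_le_of_lt ?_ hcard)
      exact Finset.card_le_two
    obtain ⟨a₂, ha₂, hn⟩ := hex
    simp only [Finset.mem_insert, Finset.mem_singleton, not_or] at hn
    exact ⟨_, a₂, _, hfin.mem_toFinset.1 (Finset.min'_mem _ hne), hfin.mem_toFinset.1 ha₂,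
      hfin.mem_toFinset.1 (Finset.max'_mem _ hne),
      lt_of_le_of_ne (Finset.min'_le _ _ ha₂) (Ne.symm hn.1),
      lt_of_le_of_ne (Finset.le_max' _ _ ha₂) hn.2⟩
  refine h₂.2 fun y r hr => ?_
  obtain ⟨y₁, hy₁⟩ := h₁.1
  obtain ⟨y₃, hy₃⟩ := h₃.1
  have e₁ := (hy₁ r).1
  have e₃ := (hy₃ r).2
  simp only [flat_append, flat_cons, flat_nil, List.append_nil, cat_append] at e₁ e₃
  rw [shift_iterate_cat_of_le hr.le] at e₁ e₃ ⊢
  exact ⟨e₁.trans (toLex_cat_le_toLex_cat _ (toLex_cat_ofFn_lt h12 _ _).le),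
    (toLex_cat_le_toLex_cat _ (toLex_cat_ofFn_lt h23 _ _).le).trans e₃⟩

end SymbolicInterval

/-! ### Two criteria for the Hausdorff dimension -/

/-- Countable covers `t n` by sets of diameter at most `r n → 0`, with the masses
`∑ (r n) ^ s` bounded in `n`, bound the dimension by `s`. -/
theorem dimH_le_of_covers {Y : Type*} [EMetricSpace Y] {S : Set Y} {s : ℝ≥0} {r : ℕ → ℝ≥0∞}
    (hr : Filter.Tendsto r Filter.atTop (𝓝 0)) {ι : ℕ → Type*} [∀ n, Countable (ι n)]
    (t : ∀ n, ι n → Set Y) (ht : ∀ n i, Metric.ediam (t n i) ≤ r n) (hst : ∀ n, S ⊆ ⋃ i, t n i)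
    {K : ℝ≥0∞} (hK : K ≠ ∞) (hsum : ∀ n, ∑' _ : ι n, r n ^ (s : ℝ) ≤ K) : dimH S ≤ s := by
  borelize Y
  refine dimH_le_of_hausdorffMeasure_ne_top (ne_top_of_le_ne_top hK ?_)
  refine (MeasureTheory.Measure.hausdorffMeasure_le_liminf_tsum s S r hr t
    (Filter.Eventually.of_forall ht) (Filter.Eventually.of_forall hst)).trans ?_
  refine Filter.liminf_le_of_frequently_le' (Filter.Frequently.of_forall fun n => ?_)
  refine le_trans (ENNReal.tsum_le_tsum fun i => ?_) (hsum n)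
  exact ENNReal.rpow_le_rpow (ht n i) s.2

/-- A Cantor set coded by sequences over `A` symbols, where points whose codes first differ at
place `k` are at least `C * ρ ^ k` apart, has dimension at least `log A / log (1 / ρ)`: reading the
code as a base `A` expansion is a Hölder map onto `[0, 1]`. -/
theorem le_dimH_range_of_le_edist {Y : Type*} [EMetricSpace Y] {A : ℕ} (hA : 1 < A)
    (G : (ℕ → Fin A) → Y) {C ρ s : ℝ≥0} (hC : 0 < C) (hs : 0 < s)
    (hρ : (A : ℝ≥0)⁻¹ ≤ ρ ^ (s : ℝ))
    (hG : ∀ p q k, (∀ i < k, p i = q i) → p k ≠ q k →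
      ((C * ρ ^ k : ℝ≥0) : ℝ≥0∞) ≤ edist (G p) (G q)) :
    (s : ℝ≥0∞) ≤ dimH (Set.range G) := by
  classical
  have hA0 : (0 : ℝ≥0) < A := by exact_mod_cast (zero_lt_one.trans hA)
  have hρ0 : 0 < ρ := by
    rcases eq_or_ne ρ 0 with rfl | h
    · rw [NNReal.zero_rpow (by exact_mod_cast hs.ne')] at hρ
      exact absurd hρ (not_le.2 (inv_pos.2 hA0))
    · exact pos_iff_ne_zero.2 h
  have hfirst : ∀ p q : ℕ → Fin A, p ≠ q → ∃ k, (∀ i < k, p i = q i) ∧ p k ≠ q k := by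
    intro p q hpq
    have hex : ∃ k, p k ≠ q k := Function.ne_iff.1 hpq
    exact ⟨Nat.find hex, fun i hi => not_not.1 (Nat.find_min hex hi), Nat.find_spec hex⟩
  have hinj : Function.Injective G := by
    intro p q hpq
    by_contra hne
    obtain ⟨k, hk, hk'⟩ := hfirst p q hne
    have := hG p q k hk hk'
    rw [hpq, edist_self, nonpos_iff_eq_zero, ENNReal.coe_eq_zero] at this
    exact absurd this (mul_pos hC (pow_pos hρ0 k)).ne'
  have : Nonempty (ℕ → Fin A) := ⟨fun _ => ⟨0, by lia⟩⟩
  set f : Y → ℝ := fun y => Real.ofDigits (Function.invFun G y) with hf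
  have hfG : ∀ p, f (G p) = Real.ofDigits p := fun p => by
    rw [hf]; simp only [Function.leftInverse_invFun hinj p]
  have hHolder : HolderOnWith ((C ^ (s : ℝ))⁻¹) s f (Set.range G) := by
    rintro _ ⟨p, rfl⟩ _ ⟨q, rfl⟩
    rw [hfG, hfG]
    rcases eq_or_ne p q with rfl | hpq
    · simp
    obtain ⟨k, hk, hk'⟩ := hfirst p q hpq
    have h1 : edist (Real.ofDigits p) (Real.ofDigits q) ≤ (((A : ℝ≥0)⁻¹ ^ k : ℝ≥0) : ℝ≥0∞) := by
      rw [edist_le_coe, ← NNReal.coe_le_coe, coe_nndist, Real.dist_eq]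
      simpa [inv_pow] using Real.abs_ofDigits_sub_ofDigits_le hk
    have h2 : (A : ℝ≥0)⁻¹ ^ k ≤ (C ^ (s : ℝ))⁻¹ * (C * ρ ^ k) ^ (s : ℝ) := by
      have hCs : C ^ (s : ℝ) ≠ 0 := (NNReal.rpow_pos hC).ne'
      rw [NNReal.mul_rpow, inv_mul_cancel_left₀ hCs, ← NNReal.rpow_natCast ρ k,
        ← NNReal.rpow_mul, mul_comm, NNReal.rpow_mul, NNReal.rpow_natCast]
      gcongr
    calc edist (Real.ofDigits p) (Real.ofDigits q) ≤ (((A : ℝ≥0)⁻¹ ^ k : ℝ≥0) : ℝ≥0∞) := h1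
      _ ≤ (((C ^ (s : ℝ))⁻¹ * (C * ρ ^ k) ^ (s : ℝ) : ℝ≥0) : ℝ≥0∞) := by exact_mod_cast h2
      _ = ((C ^ (s : ℝ))⁻¹ : ℝ≥0) * (((C * ρ ^ k : ℝ≥0) : ℝ≥0∞)) ^ (s : ℝ) := by
        rw [ENNReal.coe_mul, ENNReal.coe_rpow_of_nonneg _ s.coe_nonneg]
      _ ≤ _ := by
        gcongr
        exact hG p q k hk hk'
  have hone : (1 : ℝ≥0∞) ≤ dimH (f '' Set.range G) := by
    have hsub : Set.Icc (0 : ℝ) 1 ⊆ f '' Set.range G := by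
      intro t ht
      obtain ⟨p, _, hp⟩ := Real.ofDigits_SurjOn hA ht
      exact ⟨G p, ⟨p, rfl⟩, by rw [hfG, hp]⟩
    refine le_trans (le_of_eq ?_) (dimH_mono hsub)
    rw [Real.dimH_of_nonempty_interior (by simp)]
    simp
  have h := hone.trans (hHolder.dimH_image_le hs)
  rw [ENNReal.le_div_iff_mul_le (by left; exact_mod_cast hs.ne') (by simp), one_mul] at h
  exact h

namespace SymbolicInterval

/-! ### The metric -/

section Metric

variable {m : ℕ} {b : ℝ}

theorem dist_cat (hb : 1 < b) (u : List (Fin (m + 1))) (x y : FullShift m) :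
    (shiftMetric m b hb).dist (cat u x) (cat u y) =
      (b ^ u.length)⁻¹ * (shiftMetric m b hb).dist x y := by
  induction u with
  | nil => simp
  | cons a u ih =>
    have h : (shiftMetric m b hb).dist (cat (a :: u) x) (cat (a :: u) y) =
        b⁻¹ * (shiftMetric m b hb).dist (cat u x) (cat u y) := by
      change ∑' i, distTerm b _ _ i = b⁻¹ * ∑' i, distTerm b _ _ i
      rw [(summable_distTerm hb _ _).tsum_eq_zero_add, ← tsum_mul_left]
      simp only [distTerm, cat_cons_zero, cat_cons_succ, sub_self, abs_zero, zero_div, zero_add]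
      refine tsum_congr fun i => ?_
      rw [pow_succ b (i + 1), div_mul_eq_div_div]
      ring
    rw [h, ih, List.length_cons, pow_succ, mul_inv]
    ring

theorem exists_forall_dist_le (hb : 1 < b) :
    ∃ D : ℝ≥0, ∀ x y : FullShift m, (shiftMetric m b hb).dist x y ≤ D := by
  have hb0 : 0 < b := by linarith
  have hs : Summable (fun i : ℕ => (m : ℝ) * (b⁻¹) ^ (i + 1)) :=
    (((summable_nat_add_iff 1).2
      (summable_geometric_of_lt_one (by positivity) (inv_lt_one_of_one_lt₀ hb)))).mul_left _
  refine ⟨⟨∑' i : ℕ, (m : ℝ) * (b⁻¹) ^ (i + 1), tsum_nonneg fun i => by positivity⟩, fun x y => ?_⟩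
  refine (summable_distTerm hb x y).tsum_le_tsum (fun i => ?_) hs
  have hx : ((x i : ℕ) : ℝ) ≤ m := by exact_mod_cast Nat.lt_succ_iff.1 (x i).2
  have hy : ((y i : ℕ) : ℝ) ≤ m := by exact_mod_cast Nat.lt_succ_iff.1 (y i).2
  have hx0 : (0 : ℝ) ≤ ((x i : ℕ) : ℝ) := Nat.cast_nonneg _
  have hy0 : (0 : ℝ) ≤ ((y i : ℕ) : ℝ) := Nat.cast_nonneg _
  rw [distTerm, div_eq_mul_inv, inv_pow]
  refine mul_le_mul_of_nonneg_right ?_ (by positivity)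
  rw [abs_le]; constructor <;> linarith

theorem le_dist_of_ne (hb : 1 < b) {x y : FullShift m} {i : ℕ} (h : x i ≠ y i) :
    (b ^ (i + 1))⁻¹ ≤ (shiftMetric m b hb).dist x y := by
  have hb0 : 0 < b := by linarith
  refine le_trans ?_ ((summable_distTerm hb x y).le_tsum i fun j _ => distTerm_nonneg hb x y j)
  rw [distTerm, ← one_div]
  gcongr
  have h1 : ((x i : ℕ) : ℤ) - ((y i : ℕ) : ℤ) ≠ 0 := by
    intro h0
    exact h (Fin.ext (by lia))
  exact_mod_cast Int.one_le_abs h1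

/-- Prepending a fixed word contracts distances. -/
theorem hausdorffDim_image_cat_le (hb : 1 < b) (u : List (Fin (m + 1))) (S : Set (FullShift m)) :
    hausdorffDim b hb (cat u '' S) ≤ hausdorffDim b hb S := by
  let _ := shiftMetric m b hb
  have h : LipschitzWith 1 (cat u : FullShift m → FullShift m) := by
    refine LipschitzWith.of_dist_le_mul fun x y => ?_
    change (shiftMetric m b hb).dist _ _ ≤ _ * (shiftMetric m b hb).dist _ _
    rw [dist_cat]
    refine mul_le_mul_of_nonneg_right ?_ dist_nonneg
    exact inv_le_one_of_one_le₀ (one_le_pow₀ hb.le)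
  exact h.dimH_image_le S

variable {c d : FullShift m} {N : ℕ}

/-- If the language has finite weight at `b ^ (-s * N)`, then the cylinders of its words of each
fixed length cover the maximal invariant set with bounded `s`-dimensional mass. The real `b` is also
written as `β : ℝ≥0`. -/
theorem hausdorffDim_maximalInvariantSet_le (hb : 1 < b) (hN : 0 < N) {β s : ℝ≥0}
    (hβ : (β : ℝ) = b)
    (h : wordSum ((((β ^ (s : ℝ)) ^ N)⁻¹ : ℝ≥0) : ℝ≥0∞) (blockLanguage c d N) ≠ ∞) :
    hausdorffDim b hb (maximalInvariantSet c d) ≤ s := by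
  obtain ⟨D, hD⟩ := exists_forall_dist_le (m := m) hb
  have hβ1 : 1 < β := by rw [← NNReal.coe_lt_coe, hβ]; exact hb
  let _ := shiftMetric m b hb
  set x : ℝ≥0 := ((β ^ (s : ℝ)) ^ N)⁻¹ with hx
  have hpow : ∀ n : ℕ, ((β ^ (N * n))⁻¹) ^ (s : ℝ) = x ^ n := by
    intro n
    rw [hx, NNReal.inv_rpow, inv_pow, ← pow_mul, ← NNReal.rpow_natCast, ← NNReal.rpow_natCast,
      ← NNReal.rpow_mul, ← NNReal.rpow_mul, mul_comm]
  refine dimH_le_of_covers (r := fun n => ((D * (β ^ (N * n))⁻¹ : ℝ≥0) : ℝ≥0∞)) (s := s)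
    (ι := fun n => {u ∈ blockLanguage c d N | u.length = n}) ?_
    (fun n u => Set.range (cat (flat (u : List (Fin N → Fin (m + 1)))))) ?_ ?_
    (K := ((D ^ (s : ℝ) : ℝ≥0) : ℝ≥0∞) * wordSum x (blockLanguage c d N))
    (ENNReal.mul_ne_top ENNReal.coe_ne_top h) ?_
  · have h1 : Filter.Tendsto (fun n => D * ((β ^ N)⁻¹) ^ n) Filter.atTop (𝓝 (D * 0)) :=
      (tendsto_pow_atTop_nhds_zero_of_lt_one (zero_le)
        (inv_lt_one_of_one_lt₀ (one_lt_pow₀ hβ1 hN.ne'))).const_mul D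
    rw [mul_zero] at h1
    have h2 := ENNReal.tendsto_coe.2 h1
    simpa only [inv_pow, ← pow_mul, ENNReal.coe_zero] using h2
  · rintro n ⟨u, hu, rfl⟩
    refine Metric.ediam_le ?_
    rintro _ ⟨y, rfl⟩ _ ⟨y', rfl⟩
    rw [edist_le_coe, ← NNReal.coe_le_coe, coe_nndist]
    rw [dist_cat, length_flat, NNReal.coe_mul, NNReal.coe_inv, NNReal.coe_pow, hβ, mul_comm]
    have hb0 : 0 < b := by linarith
    gcongr
    exact hD y y'
  · intro n y hy
    have hflat : ∀ (k : ℕ) (y : FullShift m), ∃ u : List (Fin N → Fin (m + 1)),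
        u.length = k ∧ cat (flat u) (shift^[N * k] y) = y := by
      intro k
      induction k with
      | zero => exact fun y => ⟨[], rfl, rfl⟩
      | succ k ih =>
        intro y
        obtain ⟨u, hu, hcat⟩ := ih (shift^[N] y)
        refine ⟨(fun i : Fin N => y i) :: u, by simp [hu], ?_⟩
        rw [flat_cons, cat_append, mul_add, mul_one, Function.iterate_add_apply, hcat, cat_prefix]
    obtain ⟨u, hu, hcat⟩ := hflat n y
    exact Set.mem_iUnion.2 ⟨⟨u, ⟨shift^[N * n] y, by rwa [hcat]⟩, hu⟩, ⟨_, hcat⟩⟩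
  · intro n
    have h1 : (((D * (β ^ (N * n))⁻¹ : ℝ≥0) : ℝ≥0∞)) ^ (s : ℝ) =
        ((D ^ (s : ℝ) : ℝ≥0) : ℝ≥0∞) * (x : ℝ≥0∞) ^ n := by
      rw [← ENNReal.coe_rpow_of_nonneg _ s.coe_nonneg, NNReal.mul_rpow, hpow]
      push_cast
      rfl
    simp only [h1]
    rw [ENNReal.tsum_mul_left]
    gcongr
    refine le_trans (le_of_eq ?_) (wordSum_mono (Set.sep_subset (blockLanguage c d N)
      fun u => u.length = n))
    exact tsum_congr fun u => by rw [u.2.2]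

end Metric

variable {m : ℕ} {b : ℝ} {c d : FullShift m}

/-! ### The horseshoe -/

/-- Whenever `s` is below the dimension of the maximal invariant set there are, at arbitrarily large
lengths `n`, at least `b ^ (s * n)` words of length `n` that can be concatenated freely: they all
lead into a set `J` of sequences, and can be followed by every element of `J`. -/
theorem exists_horseshoe (hb : 1 < b) {β s : ℝ≥0} (hβ : (β : ℝ) = b)
    (hs : (s : ℝ≥0∞) < hausdorffDim b hb (maximalInvariantSet c d)) (k : ℕ) :
    ∃ n, k ≤ n ∧ ∃ (V : Finset (List (Fin (m + 1)))) (J : Set (FullShift m)),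
      (∀ u ∈ V, u.length = n) ∧ (∀ u ∈ V, ∀ y, cat u y ∈ J) ∧
      (∀ u ∈ V, ∀ y ∈ J, ∀ r < n, toLex c ≤ toLex (shift^[r] (cat u y)) ∧
        toLex (shift^[r] (cat u y)) ≤ toLex d) ∧
      (β ^ (s : ℝ)) ^ n ≤ (V.card : ℝ≥0) := by
  classical
  have hβ1 : 1 < β := by rw [← NNReal.coe_lt_coe, hβ]; exact hb
  obtain ⟨s', hss', hs'⟩ := ENNReal.lt_iff_exists_nnreal_btwn.1 hs
  have hss : s < s' := by exact_mod_cast hss'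
  have hs'0 : (0 : ℝ) < s' := by exact_mod_cast (zero_le (a := s)).trans_lt hss
  have hβs : 1 < β ^ (s' : ℝ) := NNReal.one_lt_rpow hβ1 hs'0
  -- With blocks of length `N` as letters, the weight of a letter is at most `1 / 4`, as required to
  -- neglect two exceptional letters per word.
  obtain ⟨N, hN⟩ := pow_unbounded_of_one_lt 4 hβs
  have hN0 : 0 < N := by
    rcases Nat.eq_zero_or_pos N with rfl | h
    · norm_num at hN
    · exact h
  set x : ℝ≥0 := ((β ^ (s' : ℝ)) ^ N)⁻¹ with hx
  have hpos : 0 < (β ^ (s' : ℝ)) ^ N := pow_pos (zero_lt_one.trans hβs) N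
  have hsum : wordSum (x : ℝ≥0∞) (blockLanguage c d N) = ∞ := by
    by_contra h
    exact absurd (hausdorffDim_maximalInvariantSet_le hb hN0 hβ h) (not_le.2 hs')
  have hx4 : 4 * (x : ℝ≥0∞) ≤ 1 := by
    have : 4 * x ≤ 1 := by
      rw [hx, ← div_eq_mul_inv, div_le_one hpos]
      exact hN.le
    exact_mod_cast this
  have hrx : (((β ^ (s : ℝ)) ^ N : ℝ≥0) : ℝ≥0∞) * (x : ℝ≥0∞) < 1 := by
    have : (β ^ (s : ℝ)) ^ N * x < 1 := by
      rw [hx, ← div_eq_mul_inv, div_lt_one hpos]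
      exact pow_lt_pow_left₀ (NNReal.rpow_lt_rpow_of_exponent_lt hβ1 (by exact_mod_cast hss))
        zero_le hN0.ne'
    exact_mod_cast this
  obtain ⟨a, ha⟩ := exists_loops (Cov := Covers c d) hx4 hrx blockLanguage_prefix
    blockLanguage_suffix encard_not_covers_le (fun u a t b h₁ h₂ => h₁.append h₂) hsum
  obtain ⟨n, hn, V, hV, hcard⟩ := ha k
  -- `J` is the cylinder of the block `a`, the start and the end of the loops.
  refine ⟨N * n, hn.trans (Nat.le_mul_of_pos_left _ hN0), V.image flat,
    Set.range (cat (List.ofFn a)), ?_, ?_, ?_, ?_⟩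
  · intro w hw
    obtain ⟨u, hu, rfl⟩ := Finset.mem_image.1 hw
    rw [length_flat, (hV u hu).1]
  · intro w hw y
    obtain ⟨u, hu, rfl⟩ := Finset.mem_image.1 hw
    obtain ⟨_, ⟨t, rfl⟩, _⟩ := hV u hu
    exact ⟨cat (flat t) y, by rw [flat_cons, cat_append]⟩
  · rintro w hw _ ⟨y, rfl⟩ r hr
    obtain ⟨u, hu, rfl⟩ := Finset.mem_image.1 hw
    exact (hV u hu).2.2 y r (by rwa [length_flat, (hV u hu).1])
  · rw [Finset.card_image_of_injective _ (flat_injective hN0), pow_mul]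
    exact hcard

/-! ### Infinite concatenations -/

/-- The infinite concatenation `w 0 w 1 w 2 …` of words that all have length `n`. Words of a
different length are cut off, or filled up with the letter `0`. -/
def concat (n : ℕ) (w : ℕ → List (Fin (m + 1))) : FullShift m :=
  fun i => (w (i / n)).getD (i % n) 0

section Concat

variable {n : ℕ} {w : ℕ → List (Fin (m + 1))}

theorem concat_apply (hn : 0 < n) (k : ℕ) {r : ℕ} (hr : r < n) :
    concat n w (n * k + r) = (w k).getD r 0 := by
  rw [concat, Nat.mul_add_div hn, Nat.div_eq_of_lt hr, add_zero, Nat.mul_add_mod,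
    Nat.mod_eq_of_lt hr]

theorem shift_iterate_concat (hn : 0 < n) (k : ℕ) :
    shift^[n * k] (concat n w) = concat n (fun i => w (i + k)) := by
  funext i
  rw [shift_iterate_apply, concat, concat, Nat.add_mul_div_left _ _ hn, Nat.add_mul_mod_self_left]

theorem concat_eq_cat (hn : 0 < n) (hw : ∀ k, (w k).length = n) :
    concat n w = cat (w 0) (concat n fun i => w (i + 1)) := by
  funext i
  rcases lt_or_ge i n with h | h
  · have := concat_apply (w := w) hn 0 h
    rw [mul_zero, zero_add] at this
    rw [this, cat_of_lt (by rwa [hw]), List.getD_eq_getElem]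
  · obtain ⟨k, rfl⟩ := Nat.exists_eq_add_of_le' h
    have h1 := cat_add_length (w 0) (concat n fun i => w (i + 1)) k
    rw [hw] at h1
    rw [h1, ← shift_iterate_concat hn 1, mul_one, shift_iterate_apply]

theorem concat_mem_maximalInvariantSet (hn : 0 < n) {V : Finset (List (Fin (m + 1)))}
    {J : Set (FullShift m)} (hlen : ∀ u ∈ V, u.length = n) (hJ : ∀ u ∈ V, ∀ y, cat u y ∈ J)
    (hV : ∀ u ∈ V, ∀ y ∈ J, ∀ r < n, toLex c ≤ toLex (shift^[r] (cat u y)) ∧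
      toLex (shift^[r] (cat u y)) ≤ toLex d) (hw : ∀ k, w k ∈ V) :
    concat n w ∈ maximalInvariantSet c d := by
  have hcat : ∀ k, concat n (fun i => w (i + k)) = cat (w k) (concat n fun i => w (i + (k + 1))) :=
    fun k => by
      rw [concat_eq_cat hn fun i => hlen _ (hw _)]
      simp only [zero_add, add_assoc, add_comm 1 k]
  intro i
  rw [← Nat.mod_add_div i n, Function.iterate_add_apply, shift_iterate_concat hn, hcat]
  refine hV _ (hw _) _ ?_ _ (Nat.mod_lt _ hn)
  rw [hcat]
  exact hJ _ (hw _) _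

end Concat

/-- The word of length `l` at the start of `x`, ordered lexicographically. -/
def initialWord (l : ℕ) (x : FullShift m) : Lex (Fin l → Fin (m + 1)) := toLex fun i => x i

theorem toLex_lt_of_initialWord_lt {l : ℕ} {x y : FullShift m}
    (h : initialWord l x < initialWord l y) : toLex x < toLex y := by
  obtain ⟨i, hi, hlt⟩ := h
  exact ⟨i, fun j hj => hi ⟨j, lt_trans hj i.2⟩ hj, hlt⟩

/-! ### The dimension of `rightEndpointSet` -/

/-- If some tail of a point of the maximal invariant set exceeds all tails from a place `q` on, then
the last of its maximal tails belongs to `rightEndpointSet`. -/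
theorem exists_shift_iterate_mem_rightEndpointSet {x : FullShift m}
    (hx : x ∈ maximalInvariantSet c d) {i q : ℕ} (hi : i < q)
    (h : ∀ k, q ≤ k → toLex (shift^[k] x) < toLex (shift^[i] x)) :
    ∃ j < q, shift^[j] x ∈ rightEndpointSet c d := by
  classical
  obtain ⟨j₀, hj₀, hmax⟩ := Finset.exists_max_image (Finset.range q)
    (fun j => toLex (shift^[j] x)) ⟨i, Finset.mem_range.2 hi⟩
  set T := (Finset.range q).filter fun j => toLex (shift^[j] x) = toLex (shift^[j₀] x) with hT
  have hne : T.Nonempty := ⟨j₀, by simp [hT, Finset.mem_range.1 hj₀]⟩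
  obtain ⟨hjq, hj⟩ := Finset.mem_filter.1 (T.max'_mem hne)
  refine ⟨T.max' hne, Finset.mem_range.1 hjq, fun k hk => ?_⟩
  rw [← Function.iterate_add_apply]
  refine ⟨(hx _).1, ?_, (hx _).2⟩
  rw [hj]
  rcases lt_or_ge (k + T.max' hne) q with hkq | hkq
  · refine lt_of_le_of_ne (hmax _ (Finset.mem_range.2 hkq)) fun heq => ?_
    have := T.le_max' _ (Finset.mem_filter.2 ⟨Finset.mem_range.2 hkq, heq⟩)
    lia
  · exact (h _ hkq).trans_le (hmax _ (Finset.mem_range.2 hi))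

theorem exists_forall_pow_add_le {u v : ℝ≥0} (hu : 1 ≤ u) (huv : u < v) :
    ∃ k : ℕ, ∀ n, k ≤ n → u ^ n + (n + 1) ≤ v ^ n := by
  have hu0 : (0 : ℝ) < u := by exact_mod_cast zero_lt_one.trans_le hu
  have hr : (1 : ℝ) < v / u := by rw [one_lt_div hu0]; exact_mod_cast huv
  have h1 := tendsto_pow_const_div_const_pow_of_one_lt 1 hr
  have h2 := tendsto_pow_const_div_const_pow_of_one_lt 0 hr
  have h3 := h1.add (h2.const_mul 2)
  simp only [mul_zero, add_zero, pow_one, pow_zero] at h3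
  obtain ⟨k, hk⟩ := Filter.eventually_atTop.1 (h3.eventually (gt_mem_nhds zero_lt_one))
  refine ⟨k, fun n hn => ?_⟩
  have h4 := hk n hn
  have hpos : (0 : ℝ) < (v / u) ^ n := by positivity
  rw [mul_one_div, ← add_div, div_lt_one hpos, div_pow, lt_div_iff₀ (pow_pos hu0 n)] at h4
  have hun : (1 : ℝ) ≤ (u : ℝ) ^ n := one_le_pow₀ (by exact_mod_cast hu)
  have h5 : (u : ℝ) ^ n + (n + 1) ≤ (v : ℝ) ^ n := by
    have hn0 : (0 : ℝ) ≤ n := Nat.cast_nonneg n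
    nlinarith
  exact_mod_cast h5

/-- In a horseshoe, the concatenations in which the largest word of length `2 * n` does not recur
still have dimension at least `s`. Behind a prefix that contains this largest word, each of them has
a tail in `rightEndpointSet c d`. -/
theorem le_hausdorffDim_rightEndpointSet (hb : 1 < b) {β s : ℝ≥0} (hβ : (β : ℝ) = b) (hs0 : 0 < s)
    (hs : (s : ℝ≥0∞) < hausdorffDim b hb (maximalInvariantSet c d)) :
    (s : ℝ≥0∞) ≤ hausdorffDim b hb (rightEndpointSet c d) := by
  classical
  have hβ1 : 1 < β := by rw [← NNReal.coe_lt_coe, hβ]; exact hb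
  -- The margin between `s` and `s'` makes up for the at most `n + 1` words removed from `V` below.
  obtain ⟨s', hss', hs'⟩ := ENNReal.lt_iff_exists_nnreal_btwn.1 hs
  have hss : s < s' := by exact_mod_cast hss'
  have hβs : 1 < β ^ (s : ℝ) := NNReal.one_lt_rpow hβ1 (by exact_mod_cast hs0)
  obtain ⟨k, hk⟩ := exists_forall_pow_add_le hβs.le
    (NNReal.rpow_lt_rpow_of_exponent_lt hβ1 (NNReal.coe_lt_coe.2 hss))
  obtain ⟨n, hn, V, J, hlen, hJ, hV, hcard⟩ := exists_horseshoe hb hβ hs' (max k 1)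
  have hn0 : 0 < n := lt_of_lt_of_le Nat.one_pos ((le_max_right k 1).trans hn)
  have hcardV := (hk n ((le_max_left k 1).trans hn)).trans hcard
  have hVne : V.Nonempty := by
    rw [← Finset.card_pos]
    have : (0 : ℝ≥0) < V.card := lt_of_lt_of_le (by positivity) hcardV
    exact_mod_cast this
  obtain ⟨v₀, hv₀⟩ := hVne
  -- `shift^[i] (concat n w₀)` carries the largest word of length `2 * n` that occurs in
  -- concatenations of words of `V`.
  obtain ⟨w₀, hw₀, i, hmax⟩ : ∃ w₀ : ℕ → List (Fin (m + 1)), (∀ k, w₀ k ∈ V) ∧ ∃ i,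
      ∀ w : ℕ → List (Fin (m + 1)), (∀ k, w k ∈ V) → ∀ j,
        initialWord (2 * n) (shift^[j] (concat n w)) ≤
          initialWord (2 * n) (shift^[i] (concat n w₀)) := by
    obtain ⟨θ, ⟨w₀, hw₀, i, rfl⟩, hθ⟩ := Set.exists_max_image
      {θ : Lex (Fin (2 * n) → Fin (m + 1)) | ∃ w, (∀ k, w k ∈ V) ∧
        ∃ j, initialWord (2 * n) (shift^[j] (concat n w)) = θ} id (Set.toFinite _)
      ⟨_, fun _ => v₀, fun _ => hv₀, 0, rfl⟩
    exact ⟨w₀, hw₀, i, fun w hw j => hθ _ ⟨w, hw, j, rfl⟩⟩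
  set z := shift^[i] (concat n w₀) with hz
  -- Only the words of `V` that do not occur in the first `2 * n` letters of `z` are kept.
  set V' := V \ (Finset.range (n + 1)).image (fun o => List.ofFn fun t : Fin n => z (o + t))
    with hV'
  have hV'V : ∀ u ∈ V', u ∈ V := fun u hu => (Finset.mem_sdiff.1 hu).1
  have hcard' : (β ^ (s : ℝ)) ^ n ≤ (V'.card : ℝ≥0) := by
    have h1 : V.card ≤ V'.card + (n + 1) := by
      have h2 := Finset.le_card_sdiff
        ((Finset.range (n + 1)).image (fun o => List.ofFn fun t : Fin n => z (o + t))) V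
      have h3 : ((Finset.range (n + 1)).image
          (fun o => List.ofFn fun t : Fin n => z (o + t))).card ≤ n + 1 :=
        Finset.card_image_le.trans_eq (Finset.card_range _)
      rw [← hV'] at h2
      lia
    have h4 : (V.card : ℝ≥0) ≤ V'.card + (n + 1) := by exact_mod_cast h1
    exact le_of_add_le_add_right (hcardV.trans h4)
  -- A word of length `2 * n` in a concatenation of words of `V'` contains one of these words, so
  -- it differs from the largest one.
  have hlt : ∀ w : ℕ → List (Fin (m + 1)), (∀ k, w k ∈ V') → ∀ j,
      initialWord (2 * n) (shift^[j] (concat n w)) < initialWord (2 * n) z := by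
    intro w hw j
    refine lt_of_le_of_ne (hmax w (fun k => hV'V _ (hw k)) j) fun heq => ?_
    have heq' : ∀ t < 2 * n, concat n w (t + j) = z t := fun t ht => by
      rw [← shift_iterate_apply j (concat n w)]
      exact congrFun (toLex_inj.1 heq) ⟨t, ht⟩
    have hr := Nat.mod_lt j hn0
    have hj := Nat.div_add_mod j n
    refine (Finset.mem_sdiff.1 (hw (j / n + 1))).2
      (Finset.mem_image.2 ⟨n - j % n, Finset.mem_range.2 (by lia), ?_⟩)
    refine List.ext_getElem (by rw [List.length_ofFn, hlen _ (hV'V _ (hw _))]) fun t h1 h2 => ?_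
    have ht : t < n := by simpa using h1
    rw [List.getElem_ofFn, ← heq' _ (by simp only; lia), ← List.getD_eq_getElem _ 0 h2,
      ← concat_apply hn0 _ ht]
    congr 1
    simp only [mul_add]
    lia
  -- The prefix has `i + 2` words, so it extends beyond the largest word, which starts at place `i`.
  set q := n * (i + 2) with hq
  have hiq : i + 2 * n ≤ q := by nlinarith
  set p := List.ofFn fun t : Fin q => concat n w₀ t with hp
  -- Prepending `p` puts the largest word in front; then some tail is a right endpoint.
  have hcover : ∀ w : ℕ → List (Fin (m + 1)), (∀ k, w k ∈ V') → cat p (concat n w) ∈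
      ⋃ j : ℕ, cat (List.ofFn fun t : Fin j => concat n w₀ t) '' rightEndpointSet c d := by
    intro w hw
    set x := cat p (concat n w) with hx
    have hxp : ∀ t < q, x t = concat n w₀ t := fun t ht => cat_ofFn_of_lt _ ht _
    have hxq : shift^[q] x = concat n w := by
      simpa [hp] using shift_iterate_length_cat p (concat n w)
    have hxc : x = concat n fun k => if k < i + 2 then w₀ k else w (k - (i + 2)) := by
      have h1 : shift^[q] (concat n fun k => if k < i + 2 then w₀ k else w (k - (i + 2))) =
          concat n w := by
        rw [hq, shift_iterate_concat hn0]
        simp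
      rw [← cat_prefix (concat n fun k => if k < i + 2 then w₀ k else w (k - (i + 2))) q, h1, hx,
        hp]
      congr 2
      funext t
      have ht : (t : ℕ) / n < i + 2 := by
        rw [Nat.div_lt_iff_lt_mul hn0, mul_comm]
        exact t.2
      simp [concat, ht]
    have hxX : x ∈ maximalInvariantSet c d := by
      rw [hxc]
      refine concat_mem_maximalInvariantSet hn0 hlen hJ hV fun k => ?_
      split_ifs
      · exact hw₀ k
      · exact hV'V _ (hw _)
    have hxz : initialWord (2 * n) (shift^[i] x) = initialWord (2 * n) z := by
      refine congrArg toLex (funext fun t => ?_)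
      rw [shift_iterate_apply, hxp _ (by have := t.2; lia), hz, shift_iterate_apply]
    obtain ⟨j, hjq, hj⟩ := exists_shift_iterate_mem_rightEndpointSet hxX (i := i) (q := q) (by lia)
      fun k hk => by
        obtain ⟨l, rfl⟩ := Nat.exists_eq_add_of_le' hk
        rw [Function.iterate_add_apply, hxq]
        exact toLex_lt_of_initialWord_lt (hxz ▸ hlt w hw l)
    refine Set.mem_iUnion.2 ⟨j, _, hj, ?_⟩
    conv_rhs => rw [← cat_prefix x j]
    congr 2
    funext t
    exact (hxp _ (t.2.trans hjq)).symm
  have hA : 1 < V'.card := by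
    have : (1 : ℝ≥0) < V'.card := (one_lt_pow₀ hβs hn0.ne').trans_le hcard'
    exact_mod_cast this
  set e := V'.equivFin.symm with he
  set G : (ℕ → Fin V'.card) → FullShift m := fun ω => cat p (concat n fun k => (e (ω k) : List _))
    with hG
  have hrange : (s : ℝ≥0∞) ≤ hausdorffDim b hb (Set.range G) := by
    let _ := shiftMetric m b hb
    have hβ0 : 0 < β := zero_lt_one.trans hβ1
    -- Codes that first differ at place `k` give sequences that differ at a place before
    -- `q + n * (k + 1)`.
    refine le_dimH_range_of_le_edist hA G (C := (β ^ (q + n))⁻¹) (ρ := (β ^ n)⁻¹)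
      (by positivity) hs0 ?_ ?_
    · rw [NNReal.inv_rpow, ← NNReal.rpow_natCast β n, ← NNReal.rpow_mul, mul_comm, NNReal.rpow_mul,
        NNReal.rpow_natCast]
      gcongr
    · intro ω ω' k _ hk
      have hne : (e (ω k) : List (Fin (m + 1))) ≠ e (ω' k) := fun h =>
        hk (e.injective (Subtype.ext h))
      have hl := hlen _ (hV'V _ (e (ω k)).2)
      have hl' := hlen _ (hV'V _ (e (ω' k)).2)
      obtain ⟨r, hr, hrne⟩ : ∃ r < n, (e (ω k) : List (Fin (m + 1))).getD r 0 ≠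
          (e (ω' k) : List (Fin (m + 1))).getD r 0 := by
        by_contra! h
        refine hne (List.ext_getElem (hl.trans hl'.symm) fun r h1 h2 => ?_)
        have := h r (hl ▸ h1)
        rwa [List.getD_eq_getElem _ _ h1, List.getD_eq_getElem _ _ h2] at this
      have hpl : p.length = q := by simp [hp]
      have hneG : G ω (n * k + r + q) ≠ G ω' (n * k + r + q) := by
        rw [hG]
        simp only
        rw [← hpl, cat_add_length, cat_add_length, concat_apply hn0 _ hr, concat_apply hn0 _ hr]
        exact hrne
      have hdist := le_dist_of_ne hb hneG
      rw [edist_nndist, ENNReal.coe_le_coe, ← NNReal.coe_le_coe, coe_nndist]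
      refine le_trans ?_ hdist
      have hb0 : 0 < b := by linarith
      rw [inv_pow, ← mul_inv, ← pow_mul, ← pow_add]
      push_cast
      rw [hβ]
      exact inv_anti₀ (pow_pos hb0 _) (pow_le_pow_right₀ hb.le (by lia))
  calc (s : ℝ≥0∞) ≤ hausdorffDim b hb (Set.range G) := hrange
    _ ≤ hausdorffDim b hb
        (⋃ j : ℕ, cat (List.ofFn fun t : Fin j => concat n w₀ t) '' rightEndpointSet c d) := by
      refine @dimH_mono _ (@MetricSpace.toEMetricSpace _ (shiftMetric m b hb)) _ _ ?_
      rintro _ ⟨ω, rfl⟩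
      exact hcover _ fun k => (e (ω k)).2
    _ = ⨆ j : ℕ, hausdorffDim b hb
        (cat (List.ofFn fun t : Fin j => concat n w₀ t) '' rightEndpointSet c d) :=
      @dimH_iUnion _ (@MetricSpace.toEMetricSpace _ (shiftMetric m b hb)) _ _ _
    _ ≤ hausdorffDim b hb (rightEndpointSet c d) :=
      iSup_le fun j => hausdorffDim_image_cat_le hb _ _

theorem rightEndpointSet_subset_maximalInvariantSet :
    rightEndpointSet c d ⊆ maximalInvariantSet c d := by
  intro x hx k
  obtain ⟨hc, hlt, hd⟩ := hx 1 le_rfl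
  cases k with
  | zero => exact ⟨hc.trans hlt.le, hd⟩
  | succ k =>
    obtain ⟨hc, hlt, hd⟩ := hx (k + 1) (by lia)
    exact ⟨hc, hlt.le.trans hd⟩

end SymbolicInterval

theorem mainTheorem6 (m : ℕ) (b : ℝ) (hb : 1 < b) (c d : SymbolicInterval.FullShift m)
    (hcd : toLex c < toLex d) :
    SymbolicInterval.hausdorffDim b hb (SymbolicInterval.rightEndpointSet c d) =
      SymbolicInterval.hausdorffDim b hb (SymbolicInterval.maximalInvariantSet c d) := by
  refine le_antisymm (@dimH_mono _ (@MetricSpace.toEMetricSpace _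
    (SymbolicInterval.shiftMetric m b hb)) _ _
    SymbolicInterval.rightEndpointSet_subset_maximalInvariantSet)
    (ENNReal.le_of_forall_nnreal_lt fun s hs => ?_)
  rcases eq_or_ne s 0 with rfl | hs0
  · simp
  · exact SymbolicInterval.le_hausdorffDim_rightEndpointSet hb
      (β := ⟨b, zero_le_one.trans hb.le⟩) rfl (pos_iff_ne_zero.2 hs0) hs
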